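/- **Theorem (general equivalence theorem for $\Phi_p$ on $\Omega_\varepsilon$).** Let $p(y\mid x,\theta)$ be a parametric model given by conditional densities with respect to a reference measure, with $\theta$ in an open subset of $\mathbb R^k$. Let $x_1,\dots,x_N$ be design points and let $M_{x}=-\mathbb E\big[\partial^2\log p(y\mid x,\theta)/\partial\theta^2\big]\in\mathbb R^{k\times k}$ be the information matrix of a point $x$ at the fixed parameter value $\theta$; assume that $M_{x_1},\dots,M_{x_N}$ are symmetric positive semidefinite (as information matrices are under the usual regularity conditions). Let $g$ be a function with values in $\mathbb R^q$, $1\le q\le k$, differentiable at $\theta$, with Jacobian $J=\partial g(\theta)/\partial\theta^T\in\mathbb R^{q\times k}$. Let $0\le p<\infty$, $0<\varepsilon<1$ and $$\Omega_\varepsilon=\Big\{w\in\mathbb R^N:\ 0\le w_i\le\varepsilon,\ \sum_{i=1}^N w_i=1\Big\},\qquad M(w)=\sum_{i=1}^N w_iM_{x_i},\qquad \Omega_\varepsilon^+=\{w\in\Omega_\varepsilon: M(w)\text{ is positive definite}\}.$$ For $w\in\Omega_\varepsilon^+$ put $\Sigma_g(w)=J\,M(w)^{-1}J^T$ and $$\Phi_p(\Sigma)=\big(q^{-1}\operatorname{Tr}(\Sigma^p)\big)^{1/p}\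 (p>0),\qquad \Phi_0(\Sigma)=|\Sigma|^{1/q},$$ $$\phi_p(x,w)=q^{-1/p}\big(\operatorname{Tr}\Sigma^p\big)^{1/p-1}\operatorname{Tr}\!\big(\Sigma^{p-1}JM(w)^{-1}M_xM(w)^{-1}J^T\big)\ (p>0),$$ $$\phi_0(x,w)=q^{-1}|\Sigma|^{1/q}\operatorname{Tr}\!\big(\Sigma^{-1}JM(w)^{-1}M_xM(w)^{-1}J^T\big),$$ where $\Sigma=\Sigma_g(w)$ in the last two lines. Powers of positive semidefinite matrices are taken on the eigenvalues; if $J$ does not have full row rank, so that $\Sigma$ is singular, the conventions $0^s=0$ for $s\neq0$ and $0^0=1$ are used. A measure $w$ is said to solve $$\min_{w\in\Omega_\varepsilon}\Phi_p(\Sigma_g(w))\tag{$*$}$$ if $w\in\Omega_\varepsilon^+$ and $\Phi_p(\Sigma_g(w))\le\Phi_p(\Sigma_g(w'))$ for all $w'\in\Omega_\varepsilon^+$ (measures with singular $M(w)$ do not compete). Then: (i) A measure $w\in\Omega_\varepsilon$ solves $(*)$ if and only if $M(w)$ is positive definite, $$\max_{w'\in\Omega_\varepsilon}\ \sum_{i=1}^N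 w_i'\,\phi_p(x_i,w)=\Phi_p(\Sigma_g(w)),$$ and the maximum is attained at $w'=w$. (ii) If $w$ solves $(*)$, then $w_i\ge w_j$ whenever $\phi_p(x_i,w)>\phi_p(x_j,w)$. -/

import Mathlib

open MeasureTheory

noncomputable section

namespace SubsampleDesign

/-- A parametric statistical model with covariates `x : 𝒳`, responses `y : 𝒴` and parameter
`θ` ranging over an open set of `ℝ^k`: conditional probability densities `p(y | x, θ)` with
respect to a reference measure on the response space. -/
structure ParametricModel (𝒳 𝒴 : Type*) [MeasurableSpace 𝒴] (k : ℕ) where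
  /-- the reference measure (Lebesgue, counting, ...) -/
  ref : Measure 𝒴
  /-- the parameter set -/
  params : Set (Fin k → ℝ)
  isOpen_params : IsOpen params
  /-- `density x θ y` is `p(y | x, θ)` -/
  density : 𝒳 → (Fin k → ℝ) → 𝒴 → ℝ
  measurable_density : ∀ x, ∀ θ ∈ params, Measurable (density x θ)
  density_nonneg : ∀ x, ∀ θ ∈ params, ∀ y, 0 ≤ density x θ y
  lintegral_density : ∀ x, ∀ θ ∈ params, ∫⁻ y, ENNReal.ofReal (density x θ y) ∂ref = 1

/-- The information matrix `M_x = -E[∂² log p(y | x, θ) / ∂θ²]` of a single point `x`, the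
expectation being over the response `y` with density `p(· | x, θ)`. -/
def ParametricModel.info {𝒳 𝒴 : Type*} [MeasurableSpace 𝒴] {k : ℕ}
    (P : ParametricModel 𝒳 𝒴 k) (θ : Fin k → ℝ) (x : 𝒳) : Matrix (Fin k) (Fin k) ℝ :=
  Matrix.of fun a b =>
    -∫ y, iteratedFDeriv ℝ 2 (fun t => Real.log (P.density x t y)) θ
        ![Pi.single a 1, Pi.single b 1] * P.density x θ y ∂P.ref

/-- The Jacobian matrix `∂g(θ)/∂θᵀ`, of size `q × k`. -/
def jacobian {k q : ℕ} (g : (Fin k → ℝ) → (Fin q → ℝ)) (θ : Fin k → ℝ) :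
    Matrix (Fin q) (Fin k) ℝ :=
  LinearMap.toMatrix' (fderiv ℝ g θ : (Fin k → ℝ) →ₗ[ℝ] (Fin q → ℝ))

/-- The set `Ω_ε` of probability weight vectors whose entries are at most `ε`. -/
def Omega (N : ℕ) (ε : ℝ) : Set (Fin N → ℝ) :=
  {w | (∀ i, 0 ≤ w i ∧ w i ≤ ε) ∧ ∑ i, w i = 1}

/-- `M(w) = ∑ᵢ wᵢ Mᵢ`, where `Mᵢ` is the information matrix of the `i`-th point. -/
def totalInfo {N k : ℕ} (I : Fin N → Matrix (Fin k) (Fin k) ℝ) (w : Fin N → ℝ) :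
    Matrix (Fin k) (Fin k) ℝ :=
  ∑ i, w i • I i

/-- The set `Ω_ε⁺` of the weight vectors in `Ω_ε` with `M(w)` positive definite. -/
def OmegaPos {N k : ℕ} (I : Fin N → Matrix (Fin k) (Fin k) ℝ) (ε : ℝ) : Set (Fin N → ℝ) :=
  {w | w ∈ Omega N ε ∧ (totalInfo I w).PosDef}

/-- `Σ_g(w) = J M(w)⁻¹ Jᵀ`, where `J` is the Jacobian matrix of `g`. -/
def covMatrix {N k q : ℕ} (I : Fin N → Matrix (Fin k) (Fin k) ℝ)
    (J : Matrix (Fin q) (Fin k) ℝ) (w : Fin N → ℝ) : Matrix (Fin q) (Fin q) ℝ :=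
  J * (totalInfo I w)⁻¹ * J.transpose

/-- The real power `A ^ s` of a positive semidefinite matrix, applied to the eigenvalues. -/
def matPow {q : ℕ} (A : Matrix (Fin q) (Fin q) ℝ) (s : ℝ) : Matrix (Fin q) (Fin q) ℝ :=
  cfc (fun t : ℝ => t ^ s) A

/-- Kiefer's criterion `Φ_p(A) = (q⁻¹ Tr(A ^ p)) ^ (1/p)` for `p > 0`, and its limit
`Φ_0(A) = |A| ^ (1/q)` for `p = 0`. -/
def Phi {q : ℕ} (p : ℝ) (A : Matrix (Fin q) (Fin q) ℝ) : ℝ :=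
  if p = 0 then A.det ^ (1 / (q : ℝ))
  else ((q : ℝ)⁻¹ * (matPow A p).trace) ^ (1 / p)

/-- The leverage `φ_p(x, w)` of a point `x` whose information matrix is `Mx`:
`q^(-1/p) (Tr Σ^p)^(1/p-1) Tr(Σ^(p-1) J M(w)⁻¹ Mx M(w)⁻¹ Jᵀ)` with `Σ = Σ_g(w)` for `p > 0`, and
its limit `q⁻¹ |Σ|^(1/q) Tr(Σ⁻¹ J M(w)⁻¹ Mx M(w)⁻¹ Jᵀ)` for `p = 0`. -/
def leverage {N k q : ℕ} (I : Fin N → Matrix (Fin k) (Fin k) ℝ)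
    (J : Matrix (Fin q) (Fin k) ℝ) (p : ℝ) (Mx : Matrix (Fin k) (Fin k) ℝ)
    (w : Fin N → ℝ) : ℝ :=
  (if p = 0 then (q : ℝ)⁻¹ * (covMatrix I J w).det ^ (1 / (q : ℝ))
    else (q : ℝ) ^ (-1 / p) * (matPow (covMatrix I J w) p).trace ^ (1 / p - 1)) *
  (matPow (covMatrix I J w) (p - 1) *
    (J * (totalInfo I w)⁻¹ * Mx * (totalInfo I w)⁻¹ * J.transpose)).trace

/-- `w` solves `min_{w ∈ Ω_ε} Φ_p(Σ_g(w))`; weights with singular `M(w)`, for which the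
objective is undefined (or `+∞`), do not compete. -/
def IsOptimal {N k q : ℕ} (I : Fin N → Matrix (Fin k) (Fin k) ℝ)
    (J : Matrix (Fin q) (Fin k) ℝ) (p ε : ℝ) (w : Fin N → ℝ) : Prop :=
  w ∈ OmegaPos I ε ∧ ∀ w' ∈ OmegaPos I ε, Phi p (covMatrix I J w) ≤ Phi p (covMatrix I J w')

end SubsampleDesign

end

/-! The criterion is never differentiated. Write L_w(X) = Tr(Σ^(p-1) J M⁻¹ X M⁻¹ Jᵀ) with M = M(w)
and Σ = Σ_g(w). It is linear in X, the leverage sum of w' is a nonnegative multiple of L_w(M(w')),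
and L_w(M(w)) = Tr Σ^p unless p = 0 and Σ is singular, where the multiple and the criterion both
vanish.

For two designs with positive definite M and M', Gauss-Markov gives M' ≥ Jᵀ Σ'⁺ J, hence L_w(M') ≥
Tr(Σ^(p+1) Σ'⁺) (`trace_matPow_mul_matPow_le`). A Klein-type Young inequality bounds p times the
last trace below by (p+1) Tr Σ^p - Tr Σ'^p (`add_one_mul_trace_matPow_sub_le`; log-determinants for
p = 0). So L_w(M') ≤ Tr Σ^p forces Φ(w) ≤ Φ(w'), which is sufficiency.

For necessity the same inequality is used at w_t = (1-t)w + tw' against the optimal w; linearity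
turns it into a bound on L_{w_t}(M(w')), and t → 0 (`leverageTrace_le_trace`). Part (ii) tests
optimality against the design with two weights exchanged. -/

section SpectralTrace

/-! ### Spectral calculus and trace inequalities -/

open Matrix

variable {n : Type*} [Fintype n] [DecidableEq n] {A B : Matrix n n ℝ}

/-- The matrix of inner products of the eigenvectors of `A` with those of `B`. -/
noncomputable def Matrix.IsHermitian.overlap (hA : A.IsHermitian) (hB : B.IsHermitian) :
    Matrix n n ℝ :=
  star (hA.eigenvectorUnitary : Matrix n n ℝ) * (hB.eigenvectorUnitary : Matrix n n ℝ)

lemma Matrix.IsHermitian.cfc_eq_mul (hA : A.IsHermitian) (f : ℝ → ℝ) :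
    cfc f A = (hA.eigenvectorUnitary : Matrix n n ℝ) * diagonal (f ∘ hA.eigenvalues) *
      star (hA.eigenvectorUnitary : Matrix n n ℝ) := by
  rw [hA.cfc_eq]
  simp [Matrix.IsHermitian.cfc, Unitary.conjStarAlgAut_apply]

lemma Matrix.IsHermitian.overlap_mul_transpose (hA : A.IsHermitian) (hB : B.IsHermitian) :
    hA.overlap hB * (hA.overlap hB)ᵀ = 1 := by
  have h : (hA.overlap hB)ᵀ = star (hA.overlap hB) := by
    rw [star_eq_conjTranspose, conjTranspose_eq_transpose_of_trivial]
  rw [h, overlap, star_mul, star_star, Matrix.mul_assoc,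
    ← Matrix.mul_assoc _ _ (hA.eigenvectorUnitary : Matrix n n ℝ)]
  simp

lemma Matrix.IsHermitian.overlap_transpose_mul (hA : A.IsHermitian) (hB : B.IsHermitian) :
    (hA.overlap hB)ᵀ * hA.overlap hB = 1 :=
  mul_eq_one_comm.mp (hA.overlap_mul_transpose hB)

lemma Matrix.IsHermitian.sum_overlap_sq_right (hA : A.IsHermitian) (hB : B.IsHermitian) (i : n) :
    ∑ j, hA.overlap hB i j ^ 2 = 1 := by
  have := congrFun (congrFun (hA.overlap_mul_transpose hB) i) i
  simpa [mul_apply, sq] using this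

lemma Matrix.IsHermitian.sum_overlap_sq_left (hA : A.IsHermitian) (hB : B.IsHermitian) (j : n) :
    ∑ i, hA.overlap hB i j ^ 2 = 1 := by
  have := congrFun (congrFun (hA.overlap_transpose_mul hB) j) j
  simpa [mul_apply, sq] using this

lemma Matrix.IsHermitian.trace_cfc (hA : A.IsHermitian) (f : ℝ → ℝ) :
    (cfc f A).trace = ∑ i, f (hA.eigenvalues i) := by
  rw [hA.cfc_eq_mul, trace_mul_cycle]
  simp [trace]

/-- The squared overlaps form a doubly stochastic matrix coupling the two spectra, so trace
inequalities for noncommuting matrices reduce to scalar ones. -/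
lemma Matrix.IsHermitian.trace_cfc_mul_cfc (hA : A.IsHermitian) (hB : B.IsHermitian)
    (f g : ℝ → ℝ) :
    (cfc f A * cfc g B).trace =
      ∑ i, ∑ j, hA.overlap hB i j ^ 2 * (f (hA.eigenvalues i) * g (hB.eigenvalues j)) := by
  have h : (hA.overlap hB)ᵀ = star (hB.eigenvectorUnitary : Matrix n n ℝ) *
      (hA.eigenvectorUnitary : Matrix n n ℝ) := by
    rw [← conjTranspose_eq_transpose_of_trivial, ← star_eq_conjTranspose, overlap, star_mul,
      star_star]
  have key : (cfc f A * cfc g B).trace = (diagonal (f ∘ hA.eigenvalues) * hA.overlap hB *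
      (diagonal (g ∘ hB.eigenvalues) * (hA.overlap hB)ᵀ)).trace := by
    rw [hA.cfc_eq_mul, hB.cfc_eq_mul, h, overlap]
    simp only [Matrix.mul_assoc]
    rw [trace_mul_comm]
    simp only [Matrix.mul_assoc]
  rw [key]
  simp only [trace, diag_apply, mul_apply (M := diagonal _ * _), diagonal_mul, transpose_apply,
    Function.comp_apply]
  refine Finset.sum_congr rfl fun i _ => Finset.sum_congr rfl fun j _ => ?_
  ring

/-- Klein's inequality, in the form of a comparison of trace functions. -/
lemma Matrix.IsHermitian.trace_cfc_sub_le (hA : A.IsHermitian) (hB : B.IsHermitian)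
    (f g a b : ℝ → ℝ)
    (h : ∀ i j, hA.overlap hB i j ≠ 0 →
      a (hA.eigenvalues i) - b (hB.eigenvalues j) ≤ f (hA.eigenvalues i) * g (hB.eigenvalues j)) :
    (cfc a A).trace - (cfc b B).trace ≤ (cfc f A * cfc g B).trace := by
  have h1 : (cfc a A).trace = ∑ i, ∑ j, hA.overlap hB i j ^ 2 * a (hA.eigenvalues i) := by
    simp_rw [hA.trace_cfc, ← Finset.sum_mul, hA.sum_overlap_sq_right hB, one_mul]
  have h2 : (cfc b B).trace = ∑ i, ∑ j, hA.overlap hB i j ^ 2 * b (hB.eigenvalues j) := by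
    rw [Finset.sum_comm]
    simp_rw [hB.trace_cfc, ← Finset.sum_mul, hA.sum_overlap_sq_left hB, one_mul]
  rw [h1, h2, hA.trace_cfc_mul_cfc hB]
  simp_rw [← Finset.sum_sub_distrib, ← mul_sub]
  refine Finset.sum_le_sum fun i _ => Finset.sum_le_sum fun j _ => ?_
  by_cases hij : hA.overlap hB i j = 0
  · simp [hij]
  · exact mul_le_mul_of_nonneg_left (h i j hij) (sq_nonneg _)

lemma Matrix.IsHermitian.overlap_apply (hA : A.IsHermitian) (hB : B.IsHermitian) (i j : n) :
    hA.overlap hB i j =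
      (hA.eigenvectorBasis i : n → ℝ) ⬝ᵥ (hB.eigenvectorBasis j : n → ℝ) := by
  simp [overlap, mul_apply, dotProduct, star_eq_conjTranspose]

/-- If the kernel of `B` is contained in that of `A`, then an eigenvector of `A` with nonzero
eigenvalue is orthogonal to the kernel of `B`. -/
lemma Matrix.IsHermitian.eigenvalues_eq_zero_of_overlap_ne_zero (hA : A.IsHermitian)
    (hB : B.IsHermitian) (hker : ∀ v, B *ᵥ v = 0 → A *ᵥ v = 0) {i j : n}
    (hij : hA.overlap hB i j ≠ 0) (hj : hB.eigenvalues j = 0) : hA.eigenvalues i = 0 := by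
  have h1 := hker _ (by rw [hB.mulVec_eigenvectorBasis j, hj, zero_smul])
  have h2 := hA.mulVec_eigenvectorBasis i
  have h3 : hA.eigenvalues i * hA.overlap hB i j = 0 := by
    rw [hA.overlap_apply, ← smul_eq_mul, ← smul_dotProduct, ← h2, ← vecMul_transpose,
      ← dotProduct_mulVec, ← conjTranspose_eq_transpose_of_trivial, hA.eq, h1, dotProduct_zero]
  exact (mul_eq_zero.mp h3).resolve_right hij

lemma Matrix.IsHermitian.continuousOn_spectrum (f : ℝ → ℝ) :
    ContinuousOn f (spectrum ℝ A) :=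
  (Matrix.finite_real_spectrum (A := A)).continuousOn f

lemma Matrix.PosSemidef.nonneg_of_mem_spectrum (hA : A.PosSemidef) {t : ℝ}
    (ht : t ∈ spectrum ℝ A) : 0 ≤ t := by
  rw [hA.1.spectrum_real_eq_range_eigenvalues] at ht
  obtain ⟨i, rfl⟩ := ht
  exact hA.eigenvalues_nonneg i

open scoped Matrix.Norms.L2Operator in
lemma Matrix.tendsto_cfc {X : Type*} {l : Filter X} {F : X → Matrix n n ℝ} {f : ℝ → ℝ}
    (hf : Continuous f) (hF : Filter.Tendsto F l (nhds A)) (hFh : ∀ᶠ x in l, (F x).IsHermitian)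
    (hA : A.IsHermitian) :
    Filter.Tendsto (fun x => cfc f (F x)) l (nhds (cfc f A)) := by
  have h : ContinuousOn (fun M : Matrix n n ℝ => cfc f M) {M | M.IsHermitian} :=
    ContinuousOn.cfc_of_mem_nhdsSet (s := Set.univ) f Filter.univ_mem continuousOn_id
      (fun M hM => hM) hf.continuousOn
  exact (h A hA).tendsto.comp (tendsto_nhdsWithin_iff.mpr ⟨hF, hFh⟩)

open scoped MatrixOrder in
lemma Matrix.PosSemidef.trace_mul_nonneg (hA : A.PosSemidef) (hB : B.PosSemidef) :
    0 ≤ (A * B).trace := by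
  obtain ⟨C, rfl⟩ := CStarAlgebra.nonneg_iff_eq_star_mul_self.mp hA.nonneg
  rw [star_eq_conjTranspose, Matrix.mul_assoc, trace_mul_comm]
  exact (hB.mul_mul_conjTranspose_same C).trace_nonneg

lemma Matrix.PosSemidef.cfc_of_nonneg (hA : A.PosSemidef) {f : ℝ → ℝ} (hf : ∀ t, 0 ≤ t → 0 ≤ f t) :
    (cfc f A).PosSemidef := by
  rw [hA.1.cfc_eq_mul]
  exact (PosSemidef.diagonal fun i => hf _ (hA.eigenvalues_nonneg i)).mul_mul_conjTranspose_same _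

lemma Matrix.PosSemidef.cfc_mul_cfc (hA : A.PosSemidef) {f g h : ℝ → ℝ}
    (hfg : ∀ t, 0 ≤ t → f t * g t = h t) : cfc f A * cfc g A = cfc h A := by
  rw [← cfc_mul f g A (IsHermitian.continuousOn_spectrum f) (IsHermitian.continuousOn_spectrum g)]
  exact cfc_congr fun t ht => hfg t (hA.nonneg_of_mem_spectrum ht)

end SpectralTrace

/-! ### Matrix powers and Young-type inequalities -/

namespace SubsampleDesign

open Matrix

/-- Weighted AM-GM: the geometric mean of a^(p+1)/b and b^p with weights p/(p+1) and 1/(p+1) is a^p.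
-/
lemma add_one_mul_rpow_sub_le {p a b : ℝ} (hp : 0 < p) (ha : 0 ≤ a) (hb : 0 ≤ b)
    (hab : b = 0 → a = 0) :
    (p + 1) * a ^ p - b ^ p ≤ p * a ^ (p + 1) * b ^ (-1 : ℝ) := by
  rcases hb.eq_or_lt with rfl | hb
  · simp [hab rfl, Real.zero_rpow hp.ne']
  have hp1 : 0 < p + 1 := by linarith
  have h := Real.geom_mean_le_arith_mean2_weighted (w₁ := p / (p + 1)) (w₂ := 1 / (p + 1))
    (p₁ := a ^ (p + 1) * b ^ (-1 : ℝ)) (p₂ := b ^ p) (by positivity) (by positivity)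
    (by positivity) (by positivity) (by field_simp)
  have e : (a ^ (p + 1) * b ^ (-1 : ℝ)) ^ (p / (p + 1)) * (b ^ p) ^ (1 / (p + 1)) = a ^ p := by
    rw [Real.mul_rpow (by positivity) (by positivity), ← Real.rpow_mul ha, ← Real.rpow_mul hb.le,
      ← Real.rpow_mul hb.le, mul_assoc, ← Real.rpow_add hb]
    have e1 : (p + 1) * (p / (p + 1)) = p := by field_simp
    have e2 : -1 * (p / (p + 1)) + p * (1 / (p + 1)) = 0 := by ring
    rw [e1, e2, Real.rpow_zero, mul_one]
  rw [e] at h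
  have h' := mul_le_mul_of_nonneg_left h hp1.le
  have e3 : (p + 1) * (p / (p + 1) * (a ^ (p + 1) * b ^ (-1 : ℝ)) + 1 / (p + 1) * b ^ p) =
      p * a ^ (p + 1) * b ^ (-1 : ℝ) + b ^ p := by field_simp
  linarith

lemma one_add_log_sub_log_le {a b : ℝ} (ha : 0 < a) (hb : 0 < b) :
    1 + Real.log a - Real.log b ≤ a * b ^ (-1 : ℝ) := by
  have := Real.log_le_sub_one_of_pos (div_pos ha hb)
  rw [Real.log_div ha.ne' hb.ne'] at this
  rw [Real.rpow_neg_one, ← div_eq_mul_inv]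
  linarith

variable {q : ℕ} {A B : Matrix (Fin q) (Fin q) ℝ}

lemma matPow_zero (hA : A.IsHermitian) : matPow A 0 = 1 := by
  simp only [matPow, Real.rpow_zero]
  exact cfc_const_one ℝ A hA

lemma posSemidef_matPow (hA : A.PosSemidef) (s : ℝ) : (matPow A s).PosSemidef :=
  hA.cfc_of_nonneg fun _ ht => Real.rpow_nonneg ht s

lemma trace_matPow_nonneg (hA : A.PosSemidef) (s : ℝ) : 0 ≤ (matPow A s).trace :=
  (posSemidef_matPow hA s).trace_nonneg

lemma matPow_mul_self (hA : A.PosSemidef) {p : ℝ} (hp : 0 < p) :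
    matPow A (p - 1) * A = matPow A p := by
  nth_rw 2 [← cfc_id ℝ A hA.1.isSelfAdjoint]
  refine hA.cfc_mul_cfc fun t ht => ?_
  rcases ht.eq_or_lt with rfl | ht
  · simp [Real.zero_rpow hp.ne']
  · rw [id, Real.rpow_sub_one ht.ne', div_mul_cancel₀ _ ht.ne']

/-- Definiteness is essential: on a kernel the convention gives 0⁻¹ · 0 = 0, not 1. This is why p =
0 with singular Σ is split off later. -/
lemma matPow_neg_one_mul_self (hA : A.PosDef) : matPow A (-1) * A = 1 := by
  nth_rw 2 [← cfc_id ℝ A hA.1.isSelfAdjoint]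
  rw [matPow, ← cfc_mul _ _ A (IsHermitian.continuousOn_spectrum _)
    (IsHermitian.continuousOn_spectrum _), ← cfc_const_one ℝ A hA.1.isSelfAdjoint]
  refine cfc_congr fun t ht => ?_
  rw [hA.1.spectrum_real_eq_range_eigenvalues] at ht
  obtain ⟨i, rfl⟩ := ht
  simp [Real.rpow_neg_one, (hA.eigenvalues_pos i).ne']

lemma self_mul_matPow_mul_self (hA : A.PosSemidef) {p : ℝ} (hp : 0 ≤ p) :
    A * matPow A (p - 1) * A = matPow A (p + 1) := by
  have h : cfc (fun t : ℝ => id t * t ^ (p - 1) * id t) A = A * matPow A (p - 1) * A := by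
    rw [cfc_mul _ _ A (IsHermitian.continuousOn_spectrum _) (IsHermitian.continuousOn_spectrum _),
      cfc_mul _ _ A (IsHermitian.continuousOn_spectrum _) (IsHermitian.continuousOn_spectrum _),
      cfc_id ℝ A hA.1.isSelfAdjoint, matPow]
  rw [← h]
  refine cfc_congr fun t ht => ?_
  rcases (hA.nonneg_of_mem_spectrum ht).eq_or_lt with rfl | ht
  · simp [Real.zero_rpow (by linarith : p + 1 ≠ 0)]
  · rw [id, Real.rpow_sub_one ht.ne', Real.rpow_add_one ht.ne']
    field_simp

/-- With 0⁻¹ = 0 the power -1 is the Moore-Penrose inverse. -/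
lemma matPow_neg_one_mul_mul (hA : A.PosSemidef) :
    matPow A (-1) * A * matPow A (-1) = matPow A (-1) := by
  nth_rw 2 [← cfc_id ℝ A hA.1.isSelfAdjoint]
  rw [matPow, ← cfc_mul _ _ A (IsHermitian.continuousOn_spectrum _)
    (IsHermitian.continuousOn_spectrum _), ← cfc_mul _ _ A (IsHermitian.continuousOn_spectrum _)
    (IsHermitian.continuousOn_spectrum _)]
  refine cfc_congr fun t ht => ?_
  simp only [id, Real.rpow_neg_one]
  rcases eq_or_ne t 0 with rfl | h
  · simp
  · field_simp

/-- A matrix version of Young's inequality for the powers `p + 1` and `-1`. -/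
lemma add_one_mul_trace_matPow_sub_le {p : ℝ} (hp : 0 < p) (hA : A.PosSemidef) (hB : B.PosSemidef)
    (hker : ∀ v, B *ᵥ v = 0 → A *ᵥ v = 0) :
    (p + 1) * (matPow A p).trace - (matPow B p).trace ≤
      p * (matPow A (p + 1) * matPow B (-1)).trace := by
  have h := hA.1.trace_cfc_sub_le hB.1 (fun t => p * t ^ (p + 1)) (fun t => t ^ (-1 : ℝ))
    (fun t => (p + 1) * t ^ p) (fun t => t ^ p) fun i j hij =>
      add_one_mul_rpow_sub_le hp (hA.eigenvalues_nonneg i) (hB.eigenvalues_nonneg j)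
        (hA.1.eigenvalues_eq_zero_of_overlap_ne_zero hB.1 hker hij)
  rw [cfc_const_mul _ _ A (IsHermitian.continuousOn_spectrum _),
    cfc_const_mul _ _ A (IsHermitian.continuousOn_spectrum _), smul_mul_assoc, trace_smul,
    trace_smul] at h
  exact h

lemma add_log_det_sub_le (hA : A.PosDef) (hB : B.PosDef) :
    q + Real.log A.det - Real.log B.det ≤ (matPow A 1 * matPow B (-1)).trace := by
  have h := hA.1.trace_cfc_sub_le hB.1 (fun t => t ^ (1 : ℝ)) (fun t => t ^ (-1 : ℝ))
    (fun t => 1 + Real.log t) (fun t => Real.log t) fun i j _ => by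
      simpa using one_add_log_sub_log_le (hA.eigenvalues_pos i) (hB.eigenvalues_pos j)
  rw [hA.1.trace_cfc, hB.1.trace_cfc, Finset.sum_add_distrib] at h
  have e : ∀ {C : Matrix (Fin q) (Fin q) ℝ} (hC : C.PosDef),
      ∑ i, Real.log (hC.1.eigenvalues i) = Real.log C.det := fun hC => by
    rw [hC.1.det_eq_prod_eigenvalues]
    exact (Real.log_prod fun i _ => (hC.eigenvalues_pos i).ne').symm
  rw [e hA, e hB] at h
  simpa [matPow] using h

/-! ### Gauss-Markov comparison of two information matrices -/

variable {k : ℕ} {M M' : Matrix (Fin k) (Fin k) ℝ}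

lemma posSemidef_conj_transpose {X : Matrix (Fin k) (Fin k) ℝ} (hX : X.PosSemidef)
    (J : Matrix (Fin q) (Fin k) ℝ) : (J * X * Jᵀ).PosSemidef := by
  simpa [conjTranspose_eq_transpose_of_trivial] using hX.mul_mul_conjTranspose_same J

/-- All Σ_g(w) with M(w) positive definite thus share one kernel, which makes pseudo-inverses
harmless in Young's inequality. -/
lemma mulVec_conj_transpose_eq_zero_iff (hM : M.PosDef) (J : Matrix (Fin q) (Fin k) ℝ)
    (v : Fin q → ℝ) : (J * M * Jᵀ) *ᵥ v = 0 ↔ Jᵀ *ᵥ v = 0 := by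
  constructor
  · intro h
    by_contra hv
    have h1 := hM.dotProduct_mulVec_pos hv
    have h2 : star (Jᵀ *ᵥ v) ⬝ᵥ M *ᵥ (Jᵀ *ᵥ v) = v ⬝ᵥ (J * M * Jᵀ) *ᵥ v := by
      rw [star_trivial, mulVec_transpose, ← dotProduct_mulVec, mulVec_mulVec, ← mulVec_transpose,
        mulVec_mulVec, Matrix.mul_assoc]
    rw [h2, h, dotProduct_zero] at h1
    exact lt_irrefl _ h1
  · intro h
    rw [← mulVec_mulVec, h, mulVec_zero]

/-- A Gauss-Markov inequality: `Jᵀ (J M⁻¹ Jᵀ)⁺ J ≤ M`. -/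
lemma posSemidef_sub_pinv (hM : M.PosDef) (J : Matrix (Fin q) (Fin k) ℝ) :
    (M - Jᵀ * matPow (J * M⁻¹ * Jᵀ) (-1) * J).PosSemidef := by
  have hS := posSemidef_conj_transpose hM.inv.posSemidef J
  set S := J * M⁻¹ * Jᵀ with hSdef
  set T := matPow S (-1) with hT
  have hTt : Tᵀ = T := by
    rw [← conjTranspose_eq_transpose_of_trivial]; exact (posSemidef_matPow hS _).1
  have hMt : Mᵀ = M := by rw [← conjTranspose_eq_transpose_of_trivial]; exact hM.1
  have hTST : T * S * T = T := matPow_neg_one_mul_mul hS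
  have hu : IsUnit M.det := (isUnit_iff_isUnit_det _).mp hM.isUnit
  have h := posSemidef_conj_transpose hM.inv.posSemidef (M - Jᵀ * T * J)
  -- The difference D satisfies D M⁻¹ Dᵀ = D because T S T = T, so it is a congruence of M⁻¹.
  have e : (M - Jᵀ * T * J) * M⁻¹ * (M - Jᵀ * T * J)ᵀ = M - Jᵀ * T * J := by
    have e1 : (M - Jᵀ * T * J)ᵀ = M - Jᵀ * T * J := by
      simp [transpose_mul, hTt, hMt, Matrix.mul_assoc]
    have e2 : Jᵀ * T * J * M⁻¹ * (Jᵀ * T * J) = Jᵀ * T * J := by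
      rw [show Jᵀ * T * J * M⁻¹ * (Jᵀ * T * J) = Jᵀ * (T * S * T) * J by
        simp only [hSdef, Matrix.mul_assoc], hTST]
    rw [e1, Matrix.sub_mul, Matrix.mul_nonsing_inv _ hu, Matrix.mul_sub,
      Matrix.sub_mul 1 _ (Jᵀ * T * J), e2, Matrix.one_mul, Matrix.sub_mul, Matrix.mul_assoc _ M⁻¹ M, Matrix.nonsing_inv_mul _ hu]
    simp
  rwa [e] at h

lemma trace_matPow_mul_matPow_le (hM : M.PosDef) (hM' : M'.PosDef) (J : Matrix (Fin q) (Fin k) ℝ)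
    {p : ℝ} (hp : 0 ≤ p) :
    (matPow (J * M⁻¹ * Jᵀ) (p + 1) * matPow (J * M'⁻¹ * Jᵀ) (-1)).trace ≤
      (matPow (J * M⁻¹ * Jᵀ) (p - 1) * (J * M⁻¹ * M' * M⁻¹ * Jᵀ)).trace := by
  have hS := posSemidef_conj_transpose hM.inv.posSemidef J
  have hD := posSemidef_conj_transpose (posSemidef_sub_pinv hM' J) (J * M⁻¹)
  have h := (posSemidef_matPow hS (p - 1)).trace_mul_nonneg hD
  have hMt : (M⁻¹)ᵀ = M⁻¹ := by
    rw [← conjTranspose_eq_transpose_of_trivial]; exact hM.inv.1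
  have e := self_mul_matPow_mul_self hS hp
  set S := J * M⁻¹ * Jᵀ with hSdef
  set T := matPow (J * M'⁻¹ * Jᵀ) (-1)
  have e1 : J * M⁻¹ * (M' - Jᵀ * T * J) * (J * M⁻¹)ᵀ =
      J * M⁻¹ * M' * M⁻¹ * Jᵀ - S * T * S := by
    rw [transpose_mul, hMt, Matrix.mul_sub, Matrix.sub_mul, hSdef]
    simp only [Matrix.mul_assoc]
  rw [e1, Matrix.mul_sub, trace_sub] at h
  have e2 : (matPow S (p - 1) * (S * T * S)).trace = (matPow S (p + 1) * T).trace := by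
    rw [← e, ← Matrix.mul_assoc, trace_mul_comm]
    simp only [Matrix.mul_assoc]
  linarith

end SubsampleDesign

/-! ### Continuous minorants of powers -/

namespace SubsampleDesign

open Matrix Filter Topology

/-- A negative power is discontinuous at 0, so it does not pass to limits at a singular Σ. The limit
argument only needs a lower bound that is exact at the limit matrix: the power is flattened below
its least nonzero eigenvalue. -/
lemma exists_continuous_le_rpow {q : ℕ} {A : Matrix (Fin q) (Fin q) ℝ} (hA : A.PosSemidef) (s : ℝ) :
    ∃ h : ℝ → ℝ, Continuous h ∧ (∀ t, 0 ≤ t → h t ≤ t ^ s) ∧ cfc h A = matPow A s := by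
  rcases le_or_gt 0 s with hs | hs
  · exact ⟨fun t => t ^ s, Real.continuous_rpow_const hs, fun _ _ => le_rfl, rfl⟩
  obtain ⟨a, ha, ha0⟩ : ∃ a : ℝ, (∀ i, hA.1.eigenvalues i ≠ 0 → a ≤ hA.1.eigenvalues i) ∧ 0 < a := by
    have h : ∀ᶠ a in 𝓝[>] (0 : ℝ), ∀ i, hA.1.eigenvalues i ≠ 0 → a ≤ hA.1.eigenvalues i := by
      refine eventually_all.mpr fun i => ?_
      by_cases hi : hA.1.eigenvalues i = 0
      · simp [hi]
      · have := (hA.eigenvalues_nonneg i).lt_of_ne' hi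
        filter_upwards [mem_nhdsWithin_of_mem_nhds (Iic_mem_nhds this)] with a ha _ using ha
    exact (h.and self_mem_nhdsWithin).exists
  have hpos : ∀ t : ℝ, 0 < max |t| a := fun t => lt_max_of_lt_right ha0
  have heq : ∀ t : ℝ, a ≤ t → |t| * max |t| a ^ (s - 1) = t ^ s := fun t ht => by
    have ht0 : 0 < t := ha0.trans_le ht
    rw [abs_of_pos ht0, max_eq_left ht, Real.rpow_sub_one ht0.ne', mul_div_cancel₀ _ ht0.ne']
  refine ⟨fun t => |t| * max |t| a ^ (s - 1), ?_, fun t ht => ?_, ?_⟩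
  · exact continuous_abs.mul ((continuous_abs.max continuous_const).rpow_const
      fun t => Or.inl (hpos t).ne')
  · rcases le_or_gt a t with hat | hat
    · exact (heq t hat).le
    · rcases ht.eq_or_lt with rfl | ht0
      · simp [Real.zero_rpow hs.ne]
      · have h1 : a ^ (s - 1) ≤ t ^ (s - 1) :=
          Real.rpow_le_rpow_of_nonpos ht0 hat.le (by linarith)
        dsimp only
        rw [abs_of_pos ht0, max_eq_right hat.le]
        calc t * a ^ (s - 1) ≤ t * t ^ (s - 1) := mul_le_mul_of_nonneg_left h1 ht
          _ = t ^ s := by rw [Real.rpow_sub_one ht0.ne', mul_div_cancel₀ _ ht0.ne']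
  · refine cfc_congr fun t ht => ?_
    rw [hA.1.spectrum_real_eq_range_eigenvalues] at ht
    obtain ⟨i, rfl⟩ := ht
    by_cases hi : hA.1.eigenvalues i = 0
    · simp [hi, Real.zero_rpow hs.ne]
    · exact heq _ (ha i hi)

lemma trace_cfc_mul_le {q : ℕ} {A B : Matrix (Fin q) (Fin q) ℝ} (hA : A.PosSemidef)
    (hB : B.PosSemidef) {f g : ℝ → ℝ} (hfg : ∀ t, 0 ≤ t → f t ≤ g t) :
    (cfc f A * B).trace ≤ (cfc g A * B).trace := by
  have h := (hA.cfc_of_nonneg (f := fun t => g t - f t)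
    fun t ht => sub_nonneg.mpr (hfg t ht)).trace_mul_nonneg hB
  rw [cfc_sub _ _ A (IsHermitian.continuousOn_spectrum _) (IsHermitian.continuousOn_spectrum _),
    Matrix.sub_mul, trace_sub] at h
  exact sub_nonneg.mp h

/-! ### Criterion, leverages and comparison of two designs -/

variable {N k q : ℕ}

lemma Phi_le_Phi_iff {p : ℝ} (hp : 0 < p) (hq : 1 ≤ q) {A B : Matrix (Fin q) (Fin q) ℝ}
    (hA : A.PosSemidef) (hB : B.PosSemidef) :
    Phi p A ≤ Phi p B ↔ (matPow A p).trace ≤ (matPow B p).trace := by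
  have hq0 : (0 : ℝ) < (q : ℝ)⁻¹ := by positivity
  rw [Phi, Phi, if_neg hp.ne', if_neg hp.ne', Real.rpow_le_rpow_iff
    (mul_nonneg hq0.le (trace_matPow_nonneg hA p)) (mul_nonneg hq0.le (trace_matPow_nonneg hB p))
    (by positivity), mul_le_mul_iff_right₀ hq0]

lemma Phi_nonneg {p : ℝ} {A : Matrix (Fin q) (Fin q) ℝ} (hA : A.PosSemidef) : 0 ≤ Phi p A := by
  rw [Phi]
  split_ifs
  · exact Real.rpow_nonneg hA.det_nonneg _
  · exact Real.rpow_nonneg (mul_nonneg (by positivity) (trace_matPow_nonneg hA p)) _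

/-- The scalar factor in the definition of the leverage. -/
noncomputable def leverageCoeff (p : ℝ) (A : Matrix (Fin q) (Fin q) ℝ) : ℝ :=
  if p = 0 then (q : ℝ)⁻¹ * A.det ^ (1 / (q : ℝ))
  else (q : ℝ) ^ (-1 / p) * (matPow A p).trace ^ (1 / p - 1)

/-- The trace factor in the definition of the leverage. -/
noncomputable def leverageTrace (I : Fin N → Matrix (Fin k) (Fin k) ℝ)
    (J : Matrix (Fin q) (Fin k) ℝ) (p : ℝ) (X : Matrix (Fin k) (Fin k) ℝ) (w : Fin N → ℝ) : ℝ :=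
  (matPow (covMatrix I J w) (p - 1) *
    (J * (totalInfo I w)⁻¹ * X * (totalInfo I w)⁻¹ * Jᵀ)).trace

lemma leverageCoeff_nonneg {p : ℝ} {A : Matrix (Fin q) (Fin q) ℝ} (hA : A.PosSemidef) :
    0 ≤ leverageCoeff p A := by
  rw [leverageCoeff]
  split_ifs
  · exact mul_nonneg (by positivity) (Real.rpow_nonneg hA.det_nonneg _)
  · exact mul_nonneg (by positivity) (Real.rpow_nonneg (trace_matPow_nonneg hA p) _)

/-- This normalisation turns bounds by Tr Σ^p into bounds by the criterion. -/
lemma leverageCoeff_mul_trace {p : ℝ} (hq : 1 ≤ q) {A : Matrix (Fin q) (Fin q) ℝ}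
    (hA : A.PosSemidef) : leverageCoeff p A * (matPow A p).trace = Phi p A := by
  have hq0 : (0 : ℝ) < q := by positivity
  rw [leverageCoeff, Phi]
  split_ifs with h
  · rw [h, matPow_zero hA.1, trace_one, Fintype.card_fin]
    field_simp
  · have hT := trace_matPow_nonneg hA p
    rw [Real.mul_rpow (by positivity) hT, Real.inv_rpow hq0.le, ← Real.rpow_neg hq0.le, neg_div,
      mul_assoc]
    congr 1
    rcases hT.eq_or_lt with hT | hT
    · rw [← hT, mul_zero, Real.zero_rpow (one_div_ne_zero h)]
    · rw [Real.rpow_sub_one hT.ne', div_mul_cancel₀ _ hT.ne']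

variable {I : Fin N → Matrix (Fin k) (Fin k) ℝ} {J : Matrix (Fin q) (Fin k) ℝ} {p : ℝ}
  {w w' : Fin N → ℝ}

lemma leverage_eq (X : Matrix (Fin k) (Fin k) ℝ) :
    leverage I J p X w = leverageCoeff p (covMatrix I J w) * leverageTrace I J p X w := rfl

lemma sum_mul_leverage (w' : Fin N → ℝ) :
    ∑ i, w' i * leverage I J p (I i) w =
      leverageCoeff p (covMatrix I J w) * leverageTrace I J p (totalInfo I w') w := by
  simp only [leverage_eq, leverageTrace, totalInfo, Matrix.mul_sum, Matrix.sum_mul, trace_sum,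
    Matrix.mul_smul, Matrix.smul_mul, trace_smul, Finset.mul_sum, smul_eq_mul]
  exact Finset.sum_congr rfl fun i _ => by ring

lemma posSemidef_covMatrix (hw : (totalInfo I w).PosDef) : (covMatrix I J w).PosSemidef :=
  posSemidef_conj_transpose hw.inv.posSemidef J

lemma covMatrix_mulVec_eq_zero (hw : (totalInfo I w).PosDef) (hw' : (totalInfo I w').PosDef)
    (v : Fin q → ℝ) (h : covMatrix I J w *ᵥ v = 0) : covMatrix I J w' *ᵥ v = 0 :=
  (mulVec_conj_transpose_eq_zero_iff hw'.inv J v).mpr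
    ((mulVec_conj_transpose_eq_zero_iff hw.inv J v).mp h)

lemma det_covMatrix_ne_zero (hw : (totalInfo I w).PosDef) (hw' : (totalInfo I w').PosDef)
    (h : (covMatrix I J w).det ≠ 0) : (covMatrix I J w').det ≠ 0 := by
  intro h'
  obtain ⟨v, hv, h0⟩ := exists_mulVec_eq_zero_iff.mpr h'
  exact h (exists_mulVec_eq_zero_iff.mp ⟨v, hv, covMatrix_mulVec_eq_zero hw' hw v h0⟩)

lemma posDef_covMatrix (hw : (totalInfo I w).PosDef) (h : (covMatrix I J w).det ≠ 0) :
    (covMatrix I J w).PosDef :=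
  (posSemidef_covMatrix hw).posDef_iff_isUnit.mpr
    ((isUnit_iff_isUnit_det _).mpr h.isUnit)

lemma leverageTrace_self (hp : 0 ≤ p) (hw : (totalInfo I w).PosDef)
    (h : p = 0 → (covMatrix I J w).det ≠ 0) :
    leverageTrace I J p (totalInfo I w) w = (matPow (covMatrix I J w) p).trace := by
  have hu : IsUnit (totalInfo I w).det := (isUnit_iff_isUnit_det _).mp hw.isUnit
  rw [leverageTrace, Matrix.mul_assoc J, Matrix.nonsing_inv_mul _ hu, Matrix.mul_one]
  change (matPow (covMatrix I J w) (p - 1) * covMatrix I J w).trace = _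
  rcases hp.eq_or_lt with rfl | hp
  · rw [zero_sub, matPow_neg_one_mul_self (posDef_covMatrix hw (h rfl)),
      matPow_zero (posSemidef_covMatrix hw).1]
  · rw [matPow_mul_self (posSemidef_covMatrix hw) hp]

lemma leverageCoeff_mul_leverageTrace_self (hp : 0 ≤ p) (hq : 1 ≤ q)
    (hw : (totalInfo I w).PosDef) :
    leverageCoeff p (covMatrix I J w) * leverageTrace I J p (totalInfo I w) w =
      Phi p (covMatrix I J w) := by
  by_cases h : p = 0 → (covMatrix I J w).det ≠ 0
  · rw [leverageTrace_self hp hw h, leverageCoeff_mul_trace hq (posSemidef_covMatrix hw)]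
  -- Here p = 0 and Σ is singular: the coefficient and the criterion are both zero.
  · push Not at h
    have hq0 : (q : ℝ) ≠ 0 := by positivity
    simp [leverageCoeff, Phi, h.1, h.2, hq0]

lemma trace_le_leverageTrace (hp : 0 ≤ p) (hq : 1 ≤ q) (hw : (totalInfo I w).PosDef)
    (hw' : (totalInfo I w').PosDef) (h : p = 0 → (covMatrix I J w).det ≠ 0)
    (hle : Phi p (covMatrix I J w') ≤ Phi p (covMatrix I J w)) :
    (matPow (covMatrix I J w) p).trace ≤ leverageTrace I J p (totalInfo I w') w := by
  have hS := posSemidef_covMatrix (J := J) hw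
  have hS' := posSemidef_covMatrix (J := J) hw'
  refine le_trans ?_ (trace_matPow_mul_matPow_le hw hw' J hp)
  change _ ≤ (matPow (covMatrix I J w) (p + 1) * matPow (covMatrix I J w') (-1)).trace
  rcases hp.eq_or_lt with rfl | hp
  · have hd := posDef_covMatrix hw (h rfl)
    have hd' := posDef_covMatrix hw' (det_covMatrix_ne_zero hw hw' (h rfl))
    have h1 := add_log_det_sub_le hd hd'
    simp only [Phi, if_true] at hle
    rw [Real.rpow_le_rpow_iff hd'.det_pos.le hd.det_pos.le (by positivity)] at hle
    have := Real.log_le_log hd'.det_pos hle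
    rw [matPow_zero hS.1, trace_one, Fintype.card_fin, zero_add]
    linarith
  · have h1 := add_one_mul_trace_matPow_sub_le hp hS hS' (covMatrix_mulVec_eq_zero hw' hw)
    rw [Phi_le_Phi_iff hp hq hS' hS] at hle
    exact le_of_mul_le_mul_left (by linarith) hp

lemma Phi_le_of_leverageTrace_le (hp : 0 ≤ p) (hq : 1 ≤ q) (hw : (totalInfo I w).PosDef)
    (hw' : (totalInfo I w').PosDef) (h : p = 0 → (covMatrix I J w).det ≠ 0)
    (hle : leverageTrace I J p (totalInfo I w') w ≤ (matPow (covMatrix I J w) p).trace) :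
    Phi p (covMatrix I J w) ≤ Phi p (covMatrix I J w') := by
  have hS := posSemidef_covMatrix (J := J) hw
  have hS' := posSemidef_covMatrix (J := J) hw'
  have hle := (trace_matPow_mul_matPow_le hw hw' J hp).trans hle
  change (matPow (covMatrix I J w) (p + 1) * matPow (covMatrix I J w') (-1)).trace ≤ _ at hle
  rcases hp.eq_or_lt with rfl | hp
  · have hd := posDef_covMatrix hw (h rfl)
    have hd' := posDef_covMatrix hw' (det_covMatrix_ne_zero hw hw' (h rfl))
    have h1 := add_log_det_sub_le hd hd'
    simp only [Phi, if_true]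
    rw [Real.rpow_le_rpow_iff hd.det_pos.le hd'.det_pos.le (by positivity)]
    rw [matPow_zero hS.1, trace_one, Fintype.card_fin, zero_add] at hle
    exact (Real.log_le_log_iff hd.det_pos hd'.det_pos).mp (by linarith)
  · have h1 := add_one_mul_trace_matPow_sub_le hp hS hS' (covMatrix_mulVec_eq_zero hw' hw)
    rw [Phi_le_Phi_iff hp hq hS hS']
    have := mul_le_mul_of_nonneg_left hle hp.le
    linarith

/-! ### Necessity along segments -/

lemma totalInfo_add (w w' : Fin N → ℝ) :
    totalInfo I (w + w') = totalInfo I w + totalInfo I w' := by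
  simp [totalInfo, add_smul, Finset.sum_add_distrib]

lemma totalInfo_smul (c : ℝ) (w : Fin N → ℝ) : totalInfo I (c • w) = c • totalInfo I w := by
  simp [totalInfo, smul_smul, Finset.smul_sum]

lemma posSemidef_totalInfo (hI : ∀ i, (I i).PosSemidef) (hw : ∀ i, 0 ≤ w i) :
    (totalInfo I w).PosSemidef :=
  posSemidef_sum _ fun i _ => (hI i).smul (hw i)

lemma convex_Omega (N : ℕ) (ε : ℝ) : Convex ℝ (Omega N ε) := by
  intro w hw w' hw' a b ha hb hab
  refine ⟨fun i => ?_, ?_⟩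
  · have h1 := hw.1 i
    have h2 := hw'.1 i
    refine ⟨add_nonneg (mul_nonneg ha h1.1) (mul_nonneg hb h2.1), ?_⟩
    calc a * w i + b * w' i ≤ a * ε + b * ε :=
          add_le_add (mul_le_mul_of_nonneg_left h1.2 ha) (mul_le_mul_of_nonneg_left h2.2 hb)
      _ = ε := by rw [← add_mul, hab, one_mul]
  · simp only [Pi.add_apply, Pi.smul_apply, smul_eq_mul, Finset.sum_add_distrib, ← Finset.mul_sum,
      hw.2, hw'.2, mul_one, hab]

lemma posDef_totalInfo_segment (hw : (totalInfo I w).PosDef) (hw' : (totalInfo I w').PosSemidef)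
    {a b : ℝ} (ha : 0 < a) (hb : 0 ≤ b) : (totalInfo I (a • w + b • w')).PosDef := by
  rw [totalInfo_add, totalInfo_smul, totalInfo_smul]
  exact (hw.smul ha).add_posSemidef (hw'.smul hb)

lemma leverageTrace_add_smul (X Y : Matrix (Fin k) (Fin k) ℝ) (a b : ℝ) :
    leverageTrace I J p (a • X + b • Y) w =
      a * leverageTrace I J p X w + b * leverageTrace I J p Y w := by
  simp [leverageTrace, Matrix.mul_add, Matrix.add_mul, trace_add]

/-- Tr Σ_t^p is the (1-t, t) average of the traces for w and w' taken at w_t. Optimality makes the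
one for w at least Tr Σ_t^p, so the one for w' is at most that. Only w and w_t need positive
definite information; M(w') may be singular. -/
lemma leverageTrace_segment_le {ε : ℝ} (hp : 0 ≤ p) (hq : 1 ≤ q) (hI : ∀ i, (I i).PosSemidef)
    (hw : IsOptimal I J p ε w) (hw' : w' ∈ Omega N ε)
    (h : p = 0 → (covMatrix I J w).det ≠ 0) {t : ℝ} (ht0 : 0 < t) (ht1 : t < 1) :
    leverageTrace I J p (totalInfo I w') ((1 - t) • w + t • w') ≤
      (matPow (covMatrix I J ((1 - t) • w + t • w')) p).trace := by
  have hwt : (totalInfo I ((1 - t) • w + t • w')).PosDef := posDef_totalInfo_segment hw.1.2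
    (posSemidef_totalInfo hI fun i => (hw'.1 i).1) (by linarith) ht0.le
  have hmem : (1 - t) • w + t • w' ∈ Omega N ε :=
    convex_Omega N ε hw.1.1 hw' (by linarith) ht0.le (by ring)
  have hdet : p = 0 → (covMatrix I J ((1 - t) • w + t • w')).det ≠ 0 := fun h0 =>
    det_covMatrix_ne_zero hw.1.2 hwt (h h0)
  have h1 := trace_le_leverageTrace hp hq hwt hw.1.2 hdet (hw.2 _ ⟨hmem, hwt⟩)
  have h2 := leverageTrace_self hp hwt hdet
  have h3 : totalInfo I ((1 - t) • w + t • w') = (1 - t) • totalInfo I w + t • totalInfo I w' := by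
    rw [totalInfo_add, totalInfo_smul, totalInfo_smul]
  rw [h3, leverageTrace_add_smul] at h2
  have h4 := mul_le_mul_of_nonneg_left h1 (by linarith : 0 ≤ 1 - t)
  exact le_of_mul_le_mul_left (by linarith) ht0

lemma leverageTrace_le_trace {ε : ℝ} (hp : 0 ≤ p) (hq : 1 ≤ q) (hI : ∀ i, (I i).PosSemidef)
    (hw : IsOptimal I J p ε w) (hw' : w' ∈ Omega N ε)
    (h : p = 0 → (covMatrix I J w).det ≠ 0) :
    leverageTrace I J p (totalInfo I w') w ≤ (matPow (covMatrix I J w) p).trace := by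
  have hM' := posSemidef_totalInfo hI fun i => (hw'.1 i).1
  have hS := posSemidef_covMatrix (J := J) hw.1.2
  have hwt : ∀ᶠ t in 𝓝[>] (0 : ℝ), (totalInfo I ((1 - t) • w + t • w')).PosDef := by
    filter_upwards [Ioo_mem_nhdsGT one_pos] with t ht
    exact posDef_totalInfo_segment hw.1.2 hM' (by linarith [ht.2]) ht.1.le
  have hM : Tendsto (fun t : ℝ => totalInfo I ((1 - t) • w + t • w')) (𝓝[>] 0)
      (𝓝 (totalInfo I w)) := by
    have hc : Continuous fun t : ℝ => totalInfo I ((1 - t) • w + t • w') := by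
      simp only [totalInfo_add, totalInfo_smul]
      fun_prop
    have := hc.tendsto 0
    simp only [sub_zero, one_smul, zero_smul, add_zero] at this
    exact this.mono_left nhdsWithin_le_nhds
  have hMinv : Tendsto (fun t : ℝ => (totalInfo I ((1 - t) • w + t • w'))⁻¹) (𝓝[>] 0)
      (𝓝 (totalInfo I w)⁻¹) := by
    have hc : ContinuousAt (fun X : Matrix (Fin k) (Fin k) ℝ => X⁻¹) (totalInfo I w) :=
      continuousAt_matrix_inv _ (by
        simpa using continuousAt_inv₀ hw.1.2.det_pos.ne')
    exact hc.tendsto.comp hM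
  have hcov : Tendsto (fun t : ℝ => covMatrix I J ((1 - t) • w + t • w')) (𝓝[>] 0)
      (𝓝 (covMatrix I J w)) := by
    have hc : Continuous fun X : Matrix (Fin k) (Fin k) ℝ => J * X * Jᵀ := by fun_prop
    exact (hc.tendsto _).comp hMinv
  have hB : Tendsto (fun t : ℝ => J * (totalInfo I ((1 - t) • w + t • w'))⁻¹ * totalInfo I w' *
      (totalInfo I ((1 - t) • w + t • w'))⁻¹ * Jᵀ) (𝓝[>] 0)
      (𝓝 (J * (totalInfo I w)⁻¹ * totalInfo I w' * (totalInfo I w)⁻¹ * Jᵀ)) := by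
    have hc : Continuous fun X : Matrix (Fin k) (Fin k) ℝ => J * X * totalInfo I w' * X * Jᵀ := by
      fun_prop
    exact (hc.tendsto _).comp hMinv
  have hherm : ∀ᶠ t in 𝓝[>] (0 : ℝ), (covMatrix I J ((1 - t) • w + t • w')).IsHermitian :=
    hwt.mono fun t ht => (posSemidef_covMatrix ht).1
  have htr : Continuous fun X : Matrix (Fin q) (Fin q) ℝ => X.trace := by fun_prop
  -- The left side is replaced by a smaller quantity that is continuous along the segment and has
  -- the desired limit.
  obtain ⟨f, hf, hfle, hfeq⟩ := exists_continuous_le_rpow hS (p - 1)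
  have hleft := (htr.tendsto _).comp ((Matrix.tendsto_cfc hf hcov hherm hS.1).mul hB)
  rw [hfeq] at hleft
  have hright := (htr.tendsto _).comp
    (Matrix.tendsto_cfc (Real.continuous_rpow_const hp) hcov hherm hS.1)
  refine le_of_tendsto_of_tendsto hleft hright ?_
  filter_upwards [hwt, Ioo_mem_nhdsGT one_pos] with t hpd ht
  refine le_trans (trace_cfc_mul_le (posSemidef_covMatrix hpd) ?_ hfle)
    (leverageTrace_segment_le hp hq hI hw hw' h ht.1 ht.2)
  have hinv : ((totalInfo I ((1 - t) • w + t • w'))⁻¹)ᵀ = (totalInfo I ((1 - t) • w + t • w'))⁻¹ := by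
    rw [← conjTranspose_eq_transpose_of_trivial]
    exact hpd.inv.1
  have := posSemidef_conj_transpose hM' (J * (totalInfo I ((1 - t) • w + t • w'))⁻¹)
  rwa [transpose_mul, hinv, ← Matrix.mul_assoc] at this

/-! ### Both directions of the equivalence -/

lemma sum_mul_leverage_self (hp : 0 ≤ p) (hq : 1 ≤ q) (hw : (totalInfo I w).PosDef) :
    ∑ i, w i * leverage I J p (I i) w = Phi p (covMatrix I J w) := by
  rw [sum_mul_leverage, leverageCoeff_mul_leverageTrace_self hp hq hw]

lemma det_ne_zero_of_leverageCoeff_ne_zero (hq : 1 ≤ q) {A : Matrix (Fin q) (Fin q) ℝ}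
    (hc : leverageCoeff p A ≠ 0) (h : p = 0) : A.det ≠ 0 := by
  intro h0
  have hq0 : (q : ℝ) ≠ 0 := by positivity
  simp [leverageCoeff, h, h0, hq0] at hc

lemma sum_mul_leverage_le {ε : ℝ} (hp : 0 ≤ p) (hq : 1 ≤ q) (hI : ∀ i, (I i).PosSemidef)
    (hw : IsOptimal I J p ε w) (hw' : w' ∈ Omega N ε) :
    ∑ i, w' i * leverage I J p (I i) w ≤ Phi p (covMatrix I J w) := by
  have hS := posSemidef_covMatrix (J := J) hw.1.2
  rw [sum_mul_leverage, ← leverageCoeff_mul_trace hq hS]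
  by_cases hc : leverageCoeff p (covMatrix I J w) = 0
  · simp [hc]
  · exact mul_le_mul_of_nonneg_left (leverageTrace_le_trace hp hq hI hw hw'
      (det_ne_zero_of_leverageCoeff_ne_zero hq hc)) (leverageCoeff_nonneg hS)

lemma isOptimal_of_sum_mul_leverage_le {ε : ℝ} (hp : 0 ≤ p) (hq : 1 ≤ q)
    (hw : w ∈ OmegaPos I ε)
    (h : ∀ w' ∈ Omega N ε, ∑ i, w' i * leverage I J p (I i) w ≤ Phi p (covMatrix I J w)) :
    IsOptimal I J p ε w := by
  refine ⟨hw, fun w' hw' => ?_⟩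
  have hS := posSemidef_covMatrix (J := J) hw.2
  have h1 := h w' hw'.1
  rw [sum_mul_leverage, ← leverageCoeff_mul_trace hq hS] at h1
  -- A vanishing coefficient means that the criterion is 0 at w, its least possible value.
  by_cases hc : leverageCoeff p (covMatrix I J w) = 0
  · rw [← leverageCoeff_mul_trace hq hS, hc, zero_mul]
    exact Phi_nonneg (posSemidef_covMatrix hw'.2)
  · exact Phi_le_of_leverageTrace_le hp hq hw.2 hw'.2
      (det_ne_zero_of_leverageCoeff_ne_zero hq hc)
      (le_of_mul_le_mul_left h1 ((leverageCoeff_nonneg hS).lt_of_ne' hc))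

/-! ### Exchange of two weights -/

lemma comp_swap_mem_Omega {ε : ℝ} (hw : w ∈ Omega N ε) (i j : Fin N) :
    w ∘ Equiv.swap i j ∈ Omega N ε :=
  ⟨fun l => hw.1 _, by rw [← hw.2]; exact Equiv.sum_comp (Equiv.swap i j) w⟩

lemma sum_comp_swap_mul (w φ : Fin N → ℝ) {i j : Fin N} (hij : i ≠ j) :
    ∑ l, (w ∘ Equiv.swap i j) l * φ l = ∑ l, w l * φ l + (w j - w i) * (φ i - φ j) := by
  rw [← sub_eq_iff_eq_add', ← Finset.sum_sub_distrib, Fintype.sum_eq_add i j hij]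
  · simp only [Function.comp_apply, Equiv.swap_apply_left, Equiv.swap_apply_right]
    ring
  · intro l hl
    rw [Function.comp_apply, Equiv.swap_apply_of_ne_of_ne hl.1 hl.2, sub_self]

end SubsampleDesign

theorem mainTheorem2 {𝒳 𝒴 : Type*} [MeasurableSpace 𝒴] {N k q : ℕ}
    (hq : 1 ≤ q) (hqk : q ≤ k)
    (P : SubsampleDesign.ParametricModel 𝒳 𝒴 k) (θ : Fin k → ℝ) (hθ : θ ∈ P.params)
    (x : Fin N → 𝒳) (hinfo : ∀ i, (P.info θ (x i)).PosSemidef)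
    (g : (Fin k → ℝ) → (Fin q → ℝ)) (hg : DifferentiableAt ℝ g θ)
    (p : ℝ) (hp : 0 ≤ p) (ε : ℝ) (hε0 : 0 < ε) (hε1 : ε < 1) :
    let I : Fin N → Matrix (Fin k) (Fin k) ℝ := fun i => P.info θ (x i)
    let J : Matrix (Fin q) (Fin k) ℝ := SubsampleDesign.jacobian g θ
    let Φ : (Fin N → ℝ) → ℝ := fun w =>
      SubsampleDesign.Phi p (SubsampleDesign.covMatrix I J w)
    let φ : Fin N → (Fin N → ℝ) → ℝ := fun i w => SubsampleDesign.leverage I J p (I i) w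
    (∀ w ∈ SubsampleDesign.Omega N ε,
      SubsampleDesign.IsOptimal I J p ε w ↔
        (SubsampleDesign.totalInfo I w).PosDef ∧
        IsGreatest ((fun w' : Fin N → ℝ => ∑ i, w' i * φ i w) '' SubsampleDesign.Omega N ε)
          (Φ w) ∧
        ∑ i, w i * φ i w = Φ w) ∧
    (∀ w, SubsampleDesign.IsOptimal I J p ε w →
      ∀ i j, φ j w < φ i w → w j ≤ w i) := by
  intro I J Φ φ
  have hself : ∀ w, (SubsampleDesign.totalInfo I w).PosDef → ∑ i, w i * φ i w = Φ w :=
    fun w hw => SubsampleDesign.sum_mul_leverage_self hp hq hw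
  refine ⟨fun w hw => ⟨fun h => ⟨h.1.2, ⟨⟨w, hw, hself w h.1.2⟩, ?_⟩, hself w h.1.2⟩,
    fun h => ?_⟩, fun w hw i j hij => ?_⟩
  · rintro _ ⟨w', hw', rfl⟩
    exact SubsampleDesign.sum_mul_leverage_le hp hq hinfo h hw'
  · exact SubsampleDesign.isOptimal_of_sum_mul_leverage_le hp hq ⟨hw, h.1⟩
      fun w' hw' => h.2.1.2 ⟨w', hw', rfl⟩
  · by_contra! hlt
    have hne : i ≠ j := by
      rintro rfl
      exact lt_irrefl _ hij
    have h1 := SubsampleDesign.sum_mul_leverage_le hp hq hinfo hw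
      (SubsampleDesign.comp_swap_mem_Omega hw.1.1 i j)
    have h2 := SubsampleDesign.sum_comp_swap_mul w (fun l => φ l w) hne
    have h3 := hself w hw.1.2
    -- This product is the gain from the exchange; its positivity would push the leverage sum above
    -- its maximum.
    have h4 := mul_pos (sub_pos.mpr hlt) (sub_pos.mpr hij)
    change ∑ l, (w ∘ Equiv.swap i j) l * φ l w ≤ Φ w at h1
    linarith
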